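/- Let $n\ge 2$, let $\alpha$ be a Euclidean norm on $\mathbb{R}^n$ (the norm of an arbitrary inner product), let $\beta:\mathbb{R}^n\to\mathbb{R}$ be a nonzero linear function, let $b=\sup\{|\beta(x)| : \alpha(x)\le 1\}$ be the $\alpha$-norm of $\beta$, and let $\varphi$ be a real-valued function of one real variable. Put $F(x)=\alpha(x)\,\varphi\!\left(\frac{\beta(x)}{\alpha(x)}\right)$ for $x\ne 0$ and $F(0)=0$. A function $F:\mathbb{R}^n\to\mathbb{R}$ is called a Minkowski norm if it is continuous, positive and smooth ($C^\infty$) on $\mathbb{R}^n\setminus\{0\}$, satisfies $F(\lambda x)=\lambda F(x)$ for all $\lambda\ge 0$ and $x\in\mathbb{R}^n$, and the Hessian matrix $\left(\frac{\partial^2}{\partial x_i\partial x_j}\,\tfrac12F^2\right)$ is positive definite at every $x\ne0$. Then $F$ is a Minkowski norm if and only if $\varphi$ is positive and smooth on $[-b,b]$ and $$\varphi(s)-s\,\varphi'(s)+(b^2-s^2)\,\varphi''(s)>0\qquad\text{for all } s\in[-b,b],$$ where smoothness and derivatives on $[-b,b]$ are understood as those of the restriction of $\varphi$ to $[-b,b]$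 (one-sided at the end points). -/

import Mathlib

open scoped ContDiff

/-- `α` is a Euclidean norm on `ℝⁿ`: the norm of some (arbitrary) inner product. -/
def IsEuclideanNorm {n : ℕ} (α : (Fin n → ℝ) → ℝ) : Prop :=
  ∃ B : LinearMap.BilinForm ℝ (Fin n → ℝ),
    (∀ x y, B x y = B y x) ∧ (∀ x, x ≠ 0 → 0 < B x x) ∧ ∀ x, α x = Real.sqrt (B x x)

/-- The `α`-norm of a linear function `β`, i.e. the dual norm `sup {|β x| : α x ≤ 1}`. -/
noncomputable def dualNormOf {n : ℕ} (α : (Fin n → ℝ) → ℝ) (β : (Fin n → ℝ) →ₗ[ℝ] ℝ) : ℝ :=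
  sSup {t : ℝ | ∃ x, α x ≤ 1 ∧ t = |β x|}

/-- The Hessian matrix `(∂²E/∂xᵢ∂xⱼ)` at `x`, in the standard linear coordinates of `ℝⁿ`. -/
noncomputable def hessianMatrix {n : ℕ} (E : (Fin n → ℝ) → ℝ) (x : Fin n → ℝ) :
    Matrix (Fin n) (Fin n) ℝ :=
  Matrix.of fun i j =>
    fderiv ℝ (fun y => fderiv ℝ E y (Pi.single j 1)) x (Pi.single i 1)

/-- A (smooth, strongly convex) Minkowski norm on `ℝⁿ`. -/
structure IsMinkowskiNorm {n : ℕ} (F : (Fin n → ℝ) → ℝ) : Prop where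
  continuous : Continuous F
  pos : ∀ x, x ≠ 0 → 0 < F x
  smooth : ContDiffOn ℝ ∞ F {x | x ≠ 0}
  homogeneous : ∀ (c : ℝ) (x : Fin n → ℝ), 0 ≤ c → F (c • x) = c * F x
  strongly_convex : ∀ x, x ≠ 0 → (hessianMatrix (fun y => (1 / 2 : ℝ) * F y ^ 2) x).PosDef

/-! Let `s = β x / α x`, `w = φ s - s φ' s`. For a vector `v` let `ξ = B x v / α x`, `τ = β v - s ξ`
and `N = B v v - ξ²`. The Hessian of `F² / 2` at `x` takes on `(v, v)` the value `(φ ξ + φ' τ)² + φ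
(w N + φ'' τ²)`. Cauchy–Schwarz orthogonally to `x` gives `τ² ≤ (b² - s²) N`, so the form is
positive once `w` and `w + (b² - s²) φ''` are. The second condition implies the first
(`sub_mul_derivWithin_pos`). Conversely, a vector that attains equality and kills the square yields
the second condition.

Smoothness of `φ` at `±b` is the delicate point, since `s` has critical points there. On a line
through a maximum of `s`, `F` is an even function of the parameter `t`; Whitney's theorem makes it
smooth in `t²`, which is a smooth function of `s` near `b`. -/

/-! ### Hadamard's lemma and Whitney's theorem on even functions -/

theorem contDiff_integral_pow_mul_comp_mul (m : ℕ) :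
    ∀ (k : ℕ) (f : ℝ → ℝ), ContDiff ℝ ∞ f →
      ContDiff ℝ m (fun t => ∫ s in (0 : ℝ)..1, s ^ k * f (s * t)) := by
  induction m with
  | zero =>
    intro k f hf
    have := hf.continuous
    exact contDiff_zero.2 (intervalIntegral.continuous_parametric_intervalIntegral_of_continuous'
      (by fun_prop) 0 1)
  | succ m ih =>
    intro k f hf
    have hf' : ContDiff ℝ ∞ (deriv f) := (contDiff_infty_iff_deriv.1 hf).2
    have hfc := hf.continuous
    have hfc' := hf'.continuous
    -- Differentiation replaces `(k, f)` by `(k + 1, f')`, so the induction runs over all `k` and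
    -- `f`.
    have hd : ∀ t, HasDerivAt (fun t => ∫ s in (0 : ℝ)..1, s ^ k * f (s * t))
        (∫ s in (0 : ℝ)..1, s ^ (k + 1) * deriv f (s * t)) t := by
      intro t
      obtain ⟨C, hC⟩ := (isCompact_Icc (a := -(|t| + 1)) (b := |t| + 1)).exists_bound_of_continuousOn
        hfc'.continuousOn
      refine (intervalIntegral.hasDerivAt_integral_of_dominated_loc_of_deriv_le
        (F' := fun t s => s ^ (k + 1) * deriv f (s * t)) (bound := fun _ => C)
        (Metric.ball_mem_nhds t one_pos) (Filter.Eventually.of_forall fun x => ?_) ?_ ?_ ?_ ?_ ?_).2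
      · exact Continuous.aestronglyMeasurable (by fun_prop)
      · exact Continuous.intervalIntegrable (by fun_prop) _ _
      · exact Continuous.aestronglyMeasurable (by fun_prop)
      · refine Filter.Eventually.of_forall fun s hs x hx => ?_
        rw [Set.uIoc_of_le zero_le_one] at hs
        have hx' : |x - t| < 1 := by simpa [Real.dist_eq] using hx
        have h1 : |x| ≤ |t| + 1 := by
          have := abs_sub_abs_le_abs_sub x t
          linarith
        have h2 : |s * x| ≤ |t| + 1 := by
          rw [abs_mul, abs_of_pos hs.1]
          nlinarith [abs_nonneg x, hs.2]
        have h3 := hC (s * x) (abs_le.1 h2)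
        rw [norm_mul, Real.norm_eq_abs (s ^ _), abs_of_nonneg (pow_nonneg hs.1.le _)]
        calc s ^ (k + 1) * ‖deriv f (s * x)‖ ≤ 1 * ‖deriv f (s * x)‖ := by
              gcongr
              exact pow_le_one₀ hs.1.le hs.2
          _ ≤ C := by simpa using h3
      · exact intervalIntegrable_const
      · refine Filter.Eventually.of_forall fun s _ x _ => ?_
        have h1 : HasDerivAt f (deriv f (s * x)) (s * x) :=
          ((hf.differentiable (by simp)) _).hasDerivAt
        have h2 : HasDerivAt (fun x => s * x) s x := by
          simpa using (hasDerivAt_id x).const_mul s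
        exact ((h1.comp x h2).const_mul (s ^ k)).congr_deriv (by ring)
    have he := funext fun t => (hd t).deriv
    push_cast
    refine contDiff_succ_iff_deriv.2 ⟨fun t => (hd t).differentiableAt, by simp, ?_⟩
    rw [he]
    exact ih (k + 1) _ hf'

/-- Hadamard's quotient is `g t = ∫ f'(s t) ds` over `[0, 1]`. -/
theorem ContDiff.exists_eq_mul_of_map_zero {f : ℝ → ℝ} (hf : ContDiff ℝ ∞ f) (h0 : f 0 = 0) :
    ∃ g : ℝ → ℝ, ContDiff ℝ ∞ g ∧ ∀ t, f t = t * g t := by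
  have hf' : ContDiff ℝ ∞ (deriv f) := (contDiff_infty_iff_deriv.1 hf).2
  refine ⟨fun t => ∫ s in (0 : ℝ)..1, s ^ 0 * deriv f (s * t),
    contDiff_infty.2 fun m => contDiff_integral_pow_mul_comp_mul m 0 _ hf', fun t => ?_⟩
  have h := intervalIntegral.integral_eq_sub_of_hasDerivAt (a := 0) (b := 1)
    (f := fun s => f (s * t)) (f' := fun s => deriv f (s * t) * t)
    (fun s _ => by
      have h1 : HasDerivAt f (deriv f (s * t)) (s * t) :=
        ((hf.differentiable (by simp)) _).hasDerivAt
      have h2 : HasDerivAt (fun s => s * t) t s := by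
        simpa using (hasDerivAt_id s).mul_const t
      exact h1.comp s h2)
    (by
      have := hf'.continuous
      exact Continuous.intervalIntegrable (by fun_prop) _ _)
  rw [intervalIntegral.integral_mul_const] at h
  simp only [one_mul, zero_mul, h0, sub_zero] at h
  simp only [pow_zero, one_mul]
  rw [← h, mul_comm]

/-- Whitney: a smooth even function is a smooth function of the square of its argument. -/
theorem ContDiff.contDiffOn_comp_sqrt_of_even {f : ℝ → ℝ} (hf : ContDiff ℝ ∞ f)
    (he : ∀ t, f (-t) = f t) : ContDiffOn ℝ ∞ (fun u => f (√u)) (Set.Ici 0) := by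
  refine contDiffOn_infty.2 fun m => ?_
  induction m generalizing f with
  | zero =>
    have := hf.continuous
    exact contDiffOn_zero.2 (Continuous.continuousOn (by fun_prop))
  | succ m ih =>
    have hf' : ContDiff ℝ ∞ (deriv f) := (contDiff_infty_iff_deriv.1 hf).2
    have hodd : ∀ t, deriv f (-t) = -deriv f t := by
      intro t
      have h := deriv_comp_neg f t
      rw [funext he] at h
      linarith
    have h0 : deriv f 0 = 0 := by
      have := hodd 0
      rw [neg_zero] at this
      linarith
    -- With `f' t = t g t`, the derivative of `f (√u)` is `g (√u) / 2`, again an even smooth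
    -- function of `√u`, so the induction closes.
    obtain ⟨g, hg, hfg⟩ := hf'.exists_eq_mul_of_map_zero h0
    have hge : ∀ t, g (-t) = g t := by
      intro t
      rcases eq_or_ne t 0 with rfl | ht
      · simp
      have h := hodd t
      rw [hfg, hfg] at h
      have : t * (g (-t) - g t) = 0 := by linarith
      rcases mul_eq_zero.1 this with h | h
      · exact absurd h ht
      · linarith
    have hfc := hf.continuous
    have hgc := hg.continuous
    have hpos : ∀ u : ℝ, 0 < u → HasDerivAt (fun u => f (√u)) (g (√u) / 2) u := by
      intro u hu
      have h1 : HasDerivAt f (deriv f (√u)) (√u) := ((hf.differentiable (by simp)) _).hasDerivAt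
      have hs : √u ≠ 0 := (Real.sqrt_pos.2 hu).ne'
      refine (h1.comp u (Real.hasDerivAt_sqrt hu.ne')).congr_deriv ?_
      rw [hfg]
      field_simp
    have hd : ∀ u ∈ Set.Ici (0 : ℝ), HasDerivWithinAt (fun u => f (√u)) (g (√u) / 2) (Set.Ici 0) u := by
      intro u hu
      rcases (Set.mem_Ici.1 hu).eq_or_lt with rfl | hu
      -- `√` is not differentiable at `0`; the one-sided derivative is the limit of the derivatives
      -- from the right.
      · refine hasDerivWithinAt_Ici_of_tendsto_deriv (s := Set.Ioi 0)
          (fun x hx => (hpos x hx).differentiableAt.differentiableWithinAt)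
          (Continuous.continuousWithinAt (by fun_prop)) self_mem_nhdsWithin ?_
        have hc : Continuous fun u : ℝ => g (√u) / 2 := by fun_prop
        refine (hc.continuousWithinAt (s := Set.Ioi 0) (x := 0)).tendsto.congr' ?_
        filter_upwards [self_mem_nhdsWithin] with x hx
        exact (hpos x hx).deriv.symm
      · exact (hpos u hu).hasDerivWithinAt
    push_cast
    refine (contDiffOn_succ_iff_derivWithin (uniqueDiffOn_Ici 0)).2
      ⟨fun u hu => (hd u hu).differentiableWithinAt, by simp, ?_⟩
    refine ((ih hg hge).div_const 2).congr fun u hu => ?_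
    exact (hd u hu).derivWithin (uniqueDiffOn_Ici 0 u hu)

/-- The hypothesis function is even in `t`. Substituting `t² = b² / s² - 1`, which is smooth up to
`s = b`, turns it into `(b / s) φ s`. -/
theorem contDiffOn_Ioc_of_contDiff_sqrt_one_add_sq_mul {φ : ℝ → ℝ} {b : ℝ} (hb : 0 < b)
    (h : ContDiff ℝ ∞ (fun t : ℝ => √(1 + t ^ 2) * φ (b / √(1 + t ^ 2)))) :
    ContDiffOn ℝ ∞ φ (Set.Ioc 0 b) := by
  have h1 := h.contDiffOn_comp_sqrt_of_even (fun t => by simp)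
  have h2 : ContDiffOn ℝ ∞ (fun s : ℝ => b ^ 2 / s ^ 2 - 1) (Set.Ioc 0 b) :=
    (contDiffOn_const.div (contDiffOn_id.pow 2) fun s hs => (pow_pos hs.1 2).ne').sub
      contDiffOn_const
  have hm : ∀ s ∈ Set.Ioc 0 b, 0 ≤ b ^ 2 / s ^ 2 - 1 := by
    intro s hs
    rw [sub_nonneg, one_le_div (pow_pos hs.1 2)]
    exact pow_le_pow_left₀ hs.1.le hs.2 2
  have h3 := (contDiffOn_id.div_const b).mul (h1.comp h2 hm)
  refine h3.congr fun s hs => ?_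
  have hs0 := hs.1
  have e : √(1 + √(b ^ 2 / s ^ 2 - 1) ^ 2) = b / s := by
    rw [Real.sq_sqrt (hm s hs), show 1 + (b ^ 2 / s ^ 2 - 1) = (b / s) ^ 2 by ring,
      Real.sqrt_sq (by positivity)]
  simp only [Function.comp, id, e]
  have : b / (b / s) = s := by field_simp
  rw [this]
  field_simp

/-! ### The Hessian of `F² / 2` -/

section HessianFormula

variable {V : Type*} [NormedAddCommGroup V] [NormedSpace ℝ V]
  {B : V →L[ℝ] V →L[ℝ] ℝ} {β : V →L[ℝ] ℝ}

theorem hasFDerivAt_sqrt_apply_self (hs : ∀ x y, B x y = B y x) {x : V} (hx : 0 < B x x) :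
    HasFDerivAt (fun y => √(B y y)) ((1 / √(B x x)) • B x) x := by
  have h : HasFDerivAt (fun y => B y y) ((2 : ℝ) • B x) x := by
    refine ((B.hasFDerivAt (x := x)).clm_apply (hasFDerivAt_id x)).congr_fderiv ?_
    ext v
    simp [hs v x]
    ring
  refine (h.sqrt hx.ne').congr_fderiv ?_
  ext v
  have := Real.sqrt_pos.2 hx
  simp
  field_simp

theorem hasFDerivAt_div_sqrt_apply_self (hs : ∀ x y, B x y = B y x) {x : V} (hx : 0 < B x x) :
    HasFDerivAt (fun y => β y / √(B y y))
      ((1 / √(B x x)) • (β - (β x / √(B x x) / √(B x x)) • B x)) x := by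
  have hp := Real.sqrt_pos.2 hx
  have hi := (hasDerivAt_inv hp.ne').comp_hasFDerivAt x (hasFDerivAt_sqrt_apply_self hs hx)
  refine ((β.hasFDerivAt (x := x)).mul hi).congr_fderiv ?_
  ext v
  simp
  field_simp
  ring

variable {φ φ₁ φ₂ : ℝ → ℝ} {I : Set ℝ}

/-- Derivatives of `φ` within `I` suffice for the chain rule, because `β y / α y` never leaves `I`.
-/
theorem hasFDerivAt_half_sq_alphaBeta (hs : ∀ x y, B x y = B y x) {x : V} (hx : 0 < B x x)
    (hI : ∀ y, β y / √(B y y) ∈ I) (h₁ : ∀ s ∈ I, HasDerivWithinAt φ (φ₁ s) I s) {s : ℝ}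
    (hsx : s = β x / √(B x x)) :
    HasFDerivAt (fun y => (1 / 2 : ℝ) * (√(B y y) * φ (β y / √(B y y))) ^ 2)
      ((φ s * (φ s - s * φ₁ s)) • B x + (√(B x x) * (φ s * φ₁ s)) • β) x := by
  have hp := Real.sqrt_pos.2 hx
  have hS := (h₁ _ (hI x)).comp_hasFDerivAt x (hasFDerivAt_div_sqrt_apply_self (β := β) hs hx)
    (Filter.Eventually.of_forall hI)
  refine ((((hasFDerivAt_sqrt_apply_self hs hx).mul hS).pow 2).const_mul (1 / 2)).congr_fderiv ?_
  ext v
  simp [← hsx]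
  have e : β x = s * √(B x x) := by rw [hsx]; field_simp
  field_simp
  ring

theorem fderiv_fderiv_half_sq_alphaBeta (hs : ∀ x y, B x y = B y x) (hp : ∀ x, x ≠ 0 → 0 < B x x)
    {x : V} (hx : x ≠ 0)
    (hI : ∀ y, β y / √(B y y) ∈ I) (h₁ : ∀ s ∈ I, HasDerivWithinAt φ (φ₁ s) I s)
    (h₂ : ∀ s ∈ I, HasDerivWithinAt φ₁ (φ₂ s) I s) {s : ℝ} (hsx : s = β x / √(B x x)) (v w : V) :
    fderiv ℝ (fun y => fderiv ℝ
        (fun y => (1 / 2 : ℝ) * (√(B y y) * φ (β y / √(B y y))) ^ 2) y v) x w =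
      φ s * (φ s - s * φ₁ s) * B w v
        + φ s * φ₁ s / √(B x x) * (β w * B x v + β v * B x w)
        - φ s * φ₁ s * s / √(B x x) ^ 2 * (B x w * B x v)
        + (φ₁ s ^ 2 + φ s * φ₂ s) * ((β w - s * (B x w / √(B x x))) *
          (β v - s * (B x v / √(B x x)))) := by
  have hq := Real.sqrt_pos.2 (hp x hx)
  have hα := hasFDerivAt_sqrt_apply_self hs (hp x hx)
  have hσ := hasFDerivAt_div_sqrt_apply_self (β := β) hs (hp x hx)
  have hev := Filter.Eventually.of_forall (f := nhds x) hI
  have hS := (h₁ _ (hI x)).comp_hasFDerivAt x hσ hev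
  have hS₁ := (h₂ _ (hI x)).comp_hasFDerivAt x hσ hev
  have hB : HasFDerivAt (fun y => B y v) (B v) x := by
    refine ((B.flip v).hasFDerivAt (x := x)).congr_fderiv ?_
    ext w
    simp [hs]
  have hE := ((hS.mul (hS.sub (hσ.mul hS₁))).mul hB).add ((hα.mul (hS.mul hS₁)).mul_const (β v))
  have key : (fun y => fderiv ℝ
        (fun y => (1 / 2 : ℝ) * (√(B y y) * φ (β y / √(B y y))) ^ 2) y v) =ᶠ[nhds x] fun y =>
      φ (β y / √(B y y)) * (φ (β y / √(B y y)) - β y / √(B y y) * φ₁ (β y / √(B y y))) * B y v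
        + √(B y y) * (φ (β y / √(B y y)) * φ₁ (β y / √(B y y))) * β v := by
    filter_upwards [isOpen_ne.mem_nhds hx] with y hy
    rw [(hasFDerivAt_half_sq_alphaBeta hs (hp y hy) hI h₁ rfl).fderiv]
    simp
  rw [key.fderiv_eq]
  refine (congrArg (fun L : V →L[ℝ] ℝ => L w) hE.fderiv).trans ?_
  simp [← hsx]
  have e : β x = s * √(B x x) := by rw [hsx]; field_simp
  rw [hs w v]
  field_simp
  ring

end HessianFormula

/-! ### Inequalities in one variable -/

/-- The function `u = √(b² - s²) (φ - s φ')` vanishes at `±b`, and `u'` is `-s` times a positive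
function. Hence `u` increases up to `0`, decreases afterwards, and is positive inside. -/
theorem sub_mul_derivWithin_pos {φ φ₁ φ₂ : ℝ → ℝ} {b : ℝ} (hb : 0 < b)
    (h₁ : ∀ s ∈ Set.Icc (-b) b, HasDerivWithinAt φ (φ₁ s) (Set.Icc (-b) b) s)
    (h₂ : ∀ s ∈ Set.Icc (-b) b, HasDerivWithinAt φ₁ (φ₂ s) (Set.Icc (-b) b) s)
    (h : ∀ s ∈ Set.Icc (-b) b, 0 < φ s - s * φ₁ s + (b ^ 2 - s ^ 2) * φ₂ s) :
    ∀ s ∈ Set.Icc (-b) b, 0 < φ s - s * φ₁ s := by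
  set u : ℝ → ℝ := fun s => √(b ^ 2 - s ^ 2) * (φ s - s * φ₁ s) with hu
  have hq : ∀ s ∈ Set.Ioo (-b) b, 0 < b ^ 2 - s ^ 2 := fun s hs => by nlinarith [hs.1, hs.2]
  have hc : ContinuousOn u (Set.Icc (-b) b) := by
    have c₁ : ContinuousOn φ (Set.Icc (-b) b) := fun s hs => (h₁ s hs).continuousWithinAt
    have c₂ : ContinuousOn φ₁ (Set.Icc (-b) b) := fun s hs => (h₂ s hs).continuousWithinAt
    fun_prop
  have hd : ∀ s ∈ Set.Ioo (-b) b, HasDerivAt u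
      (-s * ((φ s - s * φ₁ s + (b ^ 2 - s ^ 2) * φ₂ s) / √(b ^ 2 - s ^ 2))) s := by
    intro s hs
    have hn := Icc_mem_nhds hs.1 hs.2
    have hs' := Set.Ioo_subset_Icc_self hs
    have d₁ := (h₁ s hs').hasDerivAt hn
    have d₂ := (h₂ s hs').hasDerivAt hn
    have d₃ := ((((hasDerivAt_id s).pow 2).const_sub (b ^ 2)).sqrt (hq s hs).ne')
    have hr := Real.sqrt_pos.2 (hq s hs)
    refine (d₃.mul (d₁.sub ((hasDerivAt_id s).mul d₂))).congr_deriv ?_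
    have e := Real.sq_sqrt (hq s hs).le
    simp
    field_simp
    rw [e]
    ring
  have hpos : ∀ s ∈ Set.Ioo (-b) b,
      0 < (φ s - s * φ₁ s + (b ^ 2 - s ^ 2) * φ₂ s) / √(b ^ 2 - s ^ 2) := fun s hs =>
    div_pos (h s (Set.Ioo_subset_Icc_self hs)) (Real.sqrt_pos.2 (hq s hs))
  have hanti : StrictAntiOn u (Set.Icc 0 b) := by
    refine strictAntiOn_of_deriv_neg (convex_Icc 0 b)
      (hc.mono (Set.Icc_subset_Icc_left (by linarith))) fun s hs => ?_
    rw [interior_Icc] at hs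
    have hs' : s ∈ Set.Ioo (-b) b := ⟨by linarith [hs.1], hs.2⟩
    rw [(hd s hs').deriv]
    nlinarith [mul_pos hs.1 (hpos s hs')]
  have hmono : StrictMonoOn u (Set.Icc (-b) 0) := by
    refine strictMonoOn_of_deriv_pos (convex_Icc (-b) 0)
      (hc.mono (Set.Icc_subset_Icc_right hb.le)) fun s hs => ?_
    rw [interior_Icc] at hs
    have hs' : s ∈ Set.Ioo (-b) b := ⟨hs.1, by linarith [hs.2]⟩
    rw [(hd s hs').deriv]
    exact mul_pos (neg_pos.2 hs.2) (hpos s hs')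
  intro s hs
  -- At the end points `u` gives nothing, but there `b² - s² = 0` and the hypothesis is the claim.
  rcases eq_or_ne s b with rfl | hsb
  · simpa using h s hs
  rcases eq_or_ne s (-b) with rfl | hsb'
  · simpa using h _ hs
  have hs' : s ∈ Set.Ioo (-b) b := ⟨lt_of_le_of_ne hs.1 hsb'.symm, lt_of_le_of_ne hs.2 hsb⟩
  have hus : 0 < u s := by
    rcases le_total 0 s with h0 | h0
    · have := hanti ⟨h0, hs.2⟩ ⟨hb.le, le_rfl⟩ hs'.2
      simpa [hu] using this
    · have := hmono ⟨le_rfl, by linarith⟩ ⟨hs.1, h0⟩ hs'.1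
      simpa [hu] using this
  exact pos_of_mul_pos_right hus (Real.sqrt_nonneg _)

/-- For `N > 0`, `w N + f₂ τ²` is affine in `τ² ∈ [0, c N]` and positive at both ends. For `N = 0`,
`τ` vanishes and the square is `(f ξ)² > 0`. -/
theorem sq_add_mul_pos_of_sq_le {f f₁ f₂ w c τ N ξ : ℝ} (hf : 0 < f) (hw : 0 < w)
    (hc : 0 < w + c * f₂) (hτ : τ ^ 2 ≤ c * N) (hN : 0 ≤ N) (h : 0 < N + ξ ^ 2) :
    0 < (f * ξ + f₁ * τ) ^ 2 + f * (w * N + f₂ * τ ^ 2) := by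
  rcases hN.eq_or_lt with rfl | hN
  · have : τ = 0 := by nlinarith
    subst this
    have : 0 < f ^ 2 * ξ ^ 2 := mul_pos (by positivity) (by linarith)
    nlinarith
  · have : 0 < w * N + f₂ * τ ^ 2 := by
      rcases le_total 0 f₂ with h2 | h2
      · have := mul_pos hw hN
        have := mul_nonneg h2 (sq_nonneg τ)
        linarith
      · nlinarith [mul_pos hc hN]
    have := mul_pos hf this
    nlinarith [sq_nonneg (f * ξ + f₁ * τ)]

/-! ### Cauchy–Schwarz and the dual norm -/

section Geometry

variable {V : Type*} [AddCommGroup V] [Module ℝ V] {B : LinearMap.BilinForm ℝ V}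
  {β : V →ₗ[ℝ] ℝ}

theorem LinearMap.BilinForm.sq_apply_le_of_pos (hs : ∀ x y, B x y = B y x)
    (hp : ∀ x, x ≠ 0 → 0 < B x x) (x y : V) : B x y ^ 2 ≤ B x x * B y y := by
  refine LinearMap.BilinForm.apply_sq_le_of_symm B (fun x => ?_) ⟨fun x y => hs x y⟩ x y
  rcases eq_or_ne x 0 with rfl | h
  · simp
  · exact (hp x h).le

/-- This is Cauchy–Schwarz for the components of `p` and `v` orthogonal to `x`. -/
theorem sq_sub_mul_le (hs : ∀ x y, B x y = B y x) (hp : ∀ x, x ≠ 0 → 0 < B x x) {p : V}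
    (hβ : ∀ v, B p v = β v) {x : V} (hx : x ≠ 0) (v : V) :
    (β v - β x / √(B x x) * (B x v / √(B x x))) ^ 2 ≤
      (B p p - (β x / √(B x x)) ^ 2) * (B v v - (B x v / √(B x x)) ^ 2) := by
  have ha := Real.sqrt_pos.2 (hp x hx)
  have hx2 : B x x = √(B x x) ^ 2 := (Real.sq_sqrt (hp x hx).le).symm
  set a := √(B x x)
  have h := LinearMap.BilinForm.sq_apply_le_of_pos hs hp (p - (β x / a / a) • x)
    (v - (B x v / a / a) • x)
  have e1 : B (p - (β x / a / a) • x) (v - (B x v / a / a) • x) =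
      β v - β x / a * (B x v / a) := by
    simp [hβ, hx2]
    field_simp
    ring
  have e2 : B (p - (β x / a / a) • x) (p - (β x / a / a) • x) = B p p - (β x / a) ^ 2 := by
    simp [hβ, hx2, hs x p]
    field_simp
    ring
  have e3 : B (v - (B x v / a / a) • x) (v - (B x v / a / a) • x) = B v v - (B x v / a) ^ 2 := by
    simp [hx2, hs v x]
    field_simp
    ring
  rwa [e1, e2, e3] at h

theorem exists_riesz_of_pos [FiniteDimensional ℝ V] (hp : ∀ x, x ≠ 0 → 0 < B x x)
    (β : V →ₗ[ℝ] ℝ) : ∃ p, ∀ v, B p v = β v := by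
  have hinj : Function.Injective B := by
    rw [injective_iff_map_eq_zero]
    intro x hx
    by_contra h
    have := hp x h
    simp [hx] at this
  obtain ⟨p, hp⟩ := (LinearMap.injective_iff_surjective_of_finrank_eq_finrank
    (f := B) (Subspace.dual_finrank_eq (K := ℝ) (V := V)).symm).1 hinj β
  exact ⟨p, fun v => by rw [hp]⟩

theorem dualNorm_eq_sqrt (hs : ∀ x y, B x y = B y x) (hp : ∀ x, x ≠ 0 → 0 < B x x) {p : V}
    (hβ : ∀ v, B p v = β v) :
    sSup {t : ℝ | ∃ x, √(B x x) ≤ 1 ∧ t = |β x|} = √(B p p) := by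
  have hnn : ∀ x, 0 ≤ B x x := fun x => by
    rcases eq_or_ne x 0 with rfl | h
    · simp
    · exact (hp x h).le
  refine IsGreatest.csSup_eq ⟨⟨(1 / √(B p p)) • p, ?_, ?_⟩, ?_⟩
  · have e : B ((1 / √(B p p)) • p) ((1 / √(B p p)) • p) = B p p / √(B p p) ^ 2 := by
      simp
      ring
    rw [e, Real.sq_sqrt (hnn p)]
    exact Real.sqrt_le_iff.2 ⟨zero_le_one, by simpa using div_self_le_one _⟩
  · rw [map_smul, ← hβ, smul_eq_mul, abs_of_nonneg (mul_nonneg (by positivity) (hnn p))]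
    rw [one_div, inv_mul_eq_div, Real.div_sqrt]
  · rintro _ ⟨x, hx, rfl⟩
    replace hx := (Real.sqrt_le_iff.1 hx).2
    refine Real.abs_le_sqrt ?_
    rw [← hβ]
    have := LinearMap.BilinForm.sq_apply_le_of_pos hs hp p x
    nlinarith [hnn p]

theorem exists_orthonormal_pair [FiniteDimensional ℝ V] (hdim : 2 ≤ Module.finrank ℝ V)
    (hp : ∀ x, x ≠ 0 → 0 < B x x) {p : V} (hβ : ∀ v, B p v = β v) (hp0 : p ≠ 0) :
    ∃ e f : V, B e e = 1 ∧ B f f = 1 ∧ B e f = 0 ∧ β e = √(B p p) ∧ β f = 0 := by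
  have hr := Real.sqrt_pos.2 (hp p hp0)
  have hr2 := Real.sq_sqrt (hp p hp0).le
  -- Dimension at least two enters here: the kernel of `β` is nonzero.
  obtain ⟨q, hq, hq0⟩ : ∃ q, β q = 0 ∧ q ≠ 0 := by
    have h : LinearMap.ker β ≠ ⊥ :=
      LinearMap.ker_ne_bot_of_finrank_lt (by rw [Module.finrank_self]; omega)
    obtain ⟨q, hq, h0⟩ := (Submodule.ne_bot_iff _).1 h
    exact ⟨q, hq, h0⟩
  have hq1 := Real.sqrt_pos.2 (hp q hq0)
  have hq2 := Real.sq_sqrt (hp q hq0).le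
  refine ⟨(1 / √(B p p)) • p, (1 / √(B q q)) • q, ?_, ?_, ?_, ?_, ?_⟩
  · simp only [map_smul, LinearMap.smul_apply, smul_eq_mul]
    field_simp
    exact hr2.symm
  · simp only [map_smul, LinearMap.smul_apply, smul_eq_mul]
    field_simp
    exact hq2.symm
  · simp [hβ, hq]
  · simp only [map_smul, smul_eq_mul, ← hβ]
    field_simp
    exact hr2.symm
  · simp [hq]

end Geometry

/-- Positive definiteness of the matrix of a bilinear function. -/
theorem Matrix.posDef_of_bilinForm_iff {n : ℕ} (K : LinearMap.BilinForm ℝ (Fin n → ℝ))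
    (hK : ∀ v w, K v w = K w v) :
    (Matrix.of fun i j => K (Pi.single i 1) (Pi.single j 1)).PosDef ↔ ∀ v, v ≠ 0 → 0 < K v v := by
  have e : (Matrix.of fun i j => K (Pi.single i 1) (Pi.single j 1)) = K.toMatrix' := by
    ext i j
    simp [LinearMap.BilinForm.toMatrix'_apply]
  have hq : ∀ v, star v ⬝ᵥ (K.toMatrix'.mulVec v) = K v v := by
    intro v
    rw [star_trivial, ← Matrix.toBilin'_apply', Matrix.toBilin'_toMatrix']
  rw [Matrix.posDef_iff_dotProduct_mulVec, e]
  constructor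
  · intro h v hv
    rw [← hq]
    exact h.2 hv
  · refine fun h => ⟨?_, fun v hv => ?_⟩
    · ext i j
      simp [LinearMap.BilinForm.toMatrix'_apply, hK (Pi.single i 1)]
    · rw [hq]
      exact h v hv

/-! ### Positivity of the Hessian as a quadratic form -/

theorem posDef_hessianMatrix_alphaBeta_iff {n : ℕ} {B : LinearMap.BilinForm ℝ (Fin n → ℝ)}
    {β : (Fin n → ℝ) →ₗ[ℝ] ℝ} {φ φ₁ φ₂ : ℝ → ℝ} {I : Set ℝ}
    (hs : ∀ x y, B x y = B y x) (hp : ∀ x, x ≠ 0 → 0 < B x x)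
    (hI : ∀ y, β y / √(B y y) ∈ I) (h₁ : ∀ s ∈ I, HasDerivWithinAt φ (φ₁ s) I s)
    (h₂ : ∀ s ∈ I, HasDerivWithinAt φ₁ (φ₂ s) I s) {x : Fin n → ℝ} (hx : x ≠ 0) {s : ℝ}
    (hsx : s = β x / √(B x x)) :
    (hessianMatrix (fun y => (1 / 2 : ℝ) * (√(B y y) * φ (β y / √(B y y))) ^ 2) x).PosDef ↔
      ∀ v, v ≠ 0 →
        0 < (φ s * (B x v / √(B x x)) + φ₁ s * (β v - s * (B x v / √(B x x)))) ^ 2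
          + φ s * ((φ s - s * φ₁ s) * (B v v - (B x v / √(B x x)) ^ 2)
            + φ₂ s * (β v - s * (B x v / √(B x x))) ^ 2) := by
  let K : LinearMap.BilinForm ℝ (Fin n → ℝ) := LinearMap.mk₂ ℝ (fun w v =>
      φ s * (φ s - s * φ₁ s) * B w v
        + φ s * φ₁ s / √(B x x) * (β w * B x v + β v * B x w)
        - φ s * φ₁ s * s / √(B x x) ^ 2 * (B x w * B x v)
        + (φ₁ s ^ 2 + φ s * φ₂ s) * ((β w - s * (B x w / √(B x x))) *
          (β v - s * (B x v / √(B x x)))))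
    (by intros; simp; ring) (by intros; simp; ring) (by intros; simp; ring) (by intros; simp; ring)
  have hsymm : ∀ v w, K v w = K w v := by
    intro v w
    simp only [K, LinearMap.mk₂_apply, hs v w]
    ring
  have hH : hessianMatrix (fun y => (1 / 2 : ℝ) * (√(B y y) * φ (β y / √(B y y))) ^ 2) x =
      Matrix.of fun i j => K (Pi.single i 1) (Pi.single j 1) := by
    ext i j
    exact fderiv_fderiv_half_sq_alphaBeta (B := B.toContinuousBilinearMap)
      (β := β.toContinuousLinearMap) hs hp hx hI h₁ h₂ hsx (Pi.single j 1) (Pi.single i 1)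
  rw [hH, Matrix.posDef_of_bilinForm_iff K hsymm]
  refine forall₂_congr fun v _ => ?_
  have e : K v v = (φ s * (B x v / √(B x x)) + φ₁ s * (β v - s * (B x v / √(B x x)))) ^ 2
          + φ s * ((φ s - s * φ₁ s) * (B v v - (B x v / √(B x x)) ^ 2)
            + φ₂ s * (β v - s * (B x v / √(B x x))) ^ 2) := by
    simp only [K, LinearMap.mk₂_apply]
    ring
  rw [e]

/-! ### Recovering `φ` from `F` on a plane -/

section Profile

variable {n : ℕ} {B : LinearMap.BilinForm ℝ (Fin n → ℝ)} {β : (Fin n → ℝ) →ₗ[ℝ] ℝ}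
  {e f : Fin n → ℝ} {b : ℝ}

theorem sqrt_apply_smul_add_smul (hs : ∀ x y, B x y = B y x) (he : B e e = 1) (hf : B f f = 1)
    (hef : B e f = 0) (c d : ℝ) : √(B (c • e + d • f) (c • e + d • f)) = √(c ^ 2 + d ^ 2) := by
  congr 1
  simp [he, hf, hef, hs f e]
  ring

/-- The lines `±e + t f` give smoothness on `(0, b]` and `[-b, 0)` through Whitney's theorem. The
unit arc joining `-e` to `e` covers the gap at `0`; it is parametrised by `s` smoothly only inside
the interval. -/
theorem contDiffOn_of_contDiffOn_alphaBeta (hs : ∀ x y, B x y = B y x)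
    (he : B e e = 1) (hf : B f f = 1) (hef : B e f = 0) (hb : 0 < b) (hβe : β e = b)
    (hβf : β f = 0) {φ : ℝ → ℝ}
    (hF : ContDiffOn ℝ ∞ (fun x => √(B x x) * φ (β x / √(B x x))) {x | x ≠ 0}) :
    ContDiffOn ℝ ∞ φ (Set.Icc (-b) b) := by
  have hβ : ∀ c d : ℝ, β (c • e + d • f) = c * b := fun c d => by simp [hβe, hβf]
  have h1 : ContDiff ℝ ∞ (fun t : ℝ => √(1 + t ^ 2) * φ (b / √(1 + t ^ 2))) := by
    have hm : ContDiff ℝ ∞ (fun t : ℝ => (1 : ℝ) • e + t • f) := by fun_prop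
    have := hF.comp_contDiff hm fun t h => by
      have := hβ 1 t
      rw [h, map_zero] at this
      linarith
    simpa only [Function.comp_def, sqrt_apply_smul_add_smul hs he hf hef, hβ, one_pow, one_mul]
      using this
  have h2 : ContDiff ℝ ∞ (fun t : ℝ => √(1 + t ^ 2) * φ (-(b / √(1 + t ^ 2)))) := by
    have hm : ContDiff ℝ ∞ (fun t : ℝ => (-1 : ℝ) • e + t • f) := by fun_prop
    have := hF.comp_contDiff hm fun t h => by
      have := hβ (-1) t
      rw [h, map_zero] at this
      linarith
    simpa only [Function.comp_def, sqrt_apply_smul_add_smul hs he hf hef, hβ, neg_one_sq, neg_mul,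
      one_mul, neg_div] using this
  have h3 : ContDiffOn ℝ ∞ φ (Set.Ioo (-b) b) := by
    have hq : ∀ s ∈ Set.Ioo (-b) b, 0 < 1 - (s / b) ^ 2 := fun s hs => by
      rw [div_pow, sub_pos, div_lt_one (by positivity)]
      nlinarith [hs.1, hs.2]
    have hm : ContDiffOn ℝ ∞ (fun s : ℝ => (s / b) • e + √(1 - (s / b) ^ 2) • f)
        (Set.Ioo (-b) b) := by
      have : ContDiffOn ℝ ∞ (fun s : ℝ => √(1 - (s / b) ^ 2)) (Set.Ioo (-b) b) :=
        ContDiffOn.sqrt (by fun_prop) fun s hs => (hq s hs).ne'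
      fun_prop
    have hα : ∀ s ∈ Set.Ioo (-b) b, √((s / b) ^ 2 + √(1 - (s / b) ^ 2) ^ 2) = 1 := by
      intro s hs
      rw [Real.sq_sqrt (hq s hs).le]
      simp
    refine (hF.comp hm fun s hs' h => ?_).congr fun s hs' => ?_
    · have := hα s hs'
      rw [← sqrt_apply_smul_add_smul hs he hf hef, h] at this
      simp at this
    · simp only [Function.comp_def, sqrt_apply_smul_add_smul hs he hf hef, hβ, hα s hs']
      field_simp
  have h4 := contDiffOn_Ioc_of_contDiff_sqrt_one_add_sq_mul hb h1
  have h5 : ContDiffOn ℝ ∞ φ (Set.Ico (-b) 0) := by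
    have := (contDiffOn_Ioc_of_contDiff_sqrt_one_add_sq_mul (φ := fun s => φ (-s)) hb h2).comp
      (s := Set.Ico (-b) 0) (f := fun s => -s) (by fun_prop)
      (fun s hs => ⟨by linarith [hs.2], by linarith [hs.1]⟩)
    simpa [Function.comp_def] using this
  intro s hs'
  rcases lt_trichotomy s 0 with h | rfl | h
  · refine (h5 s ⟨hs'.1, h⟩).mono_of_mem_nhdsWithin ?_
    filter_upwards [self_mem_nhdsWithin, mem_nhdsWithin_of_mem_nhds (Iio_mem_nhds h)] with y hy hy'
    exact ⟨hy.1, hy'⟩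
  · exact (h3.contDiffAt (Ioo_mem_nhds (by linarith) hb)).contDiffWithinAt
  · refine (h4 s ⟨h, hs'.2⟩).mono_of_mem_nhdsWithin ?_
    filter_upwards [self_mem_nhdsWithin, mem_nhdsWithin_of_mem_nhds (Ioi_mem_nhds h)] with y hy hy'
    exact ⟨hy', hy.2⟩

/-- Rotate `(e, f)` by the angle whose cosine is `s / b`. The value of `β y ^ 2` is the equality
case of `sq_sub_mul_le`. -/
theorem exists_unit_apply_eq (hs : ∀ x y, B x y = B y x)
    (he : B e e = 1) (hf : B f f = 1) (hef : B e f = 0) (hb : 0 < b) (hβe : β e = b)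
    (hβf : β f = 0) {s : ℝ} (hsb : s ∈ Set.Icc (-b) b) :
    ∃ x y, B x x = 1 ∧ B y y = 1 ∧ B x y = 0 ∧ β x = s ∧ β y ^ 2 = b ^ 2 - s ^ 2 := by
  have hq : 0 ≤ 1 - (s / b) ^ 2 := by
    rw [div_pow, sub_nonneg, div_le_one (by positivity)]
    nlinarith [hsb.1, hsb.2]
  have hr := Real.sq_sqrt hq
  set r := √(1 - (s / b) ^ 2)
  refine ⟨(s / b) • e + r • f, (-r) • e + (s / b) • f, ?_, ?_, ?_, ?_, ?_⟩
  · simp [he, hf, hef, hs f e]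
    linear_combination hr
  · simp [he, hf, hef, hs f e]
    linear_combination hr
  · simp [he, hf, hef, hs f e]
    ring
  · simp [hβe, hβf]
    field_simp
  · simp [hβe, hβf, mul_pow, hr]
    field_simp

end Profile

/-- At `x = 0` the expression `α x * φ (β x / α x)` is `0`, the value forced by homogeneity.
The derivatives of `φ` at the points of `[-b, b]` are taken within `[-b, b]`
(one-sided at the end points); only the values of `φ` on `[-b, b]` matter. -/
theorem corollary3p2 (n : ℕ) (hn : 2 ≤ n)
    (α : (Fin n → ℝ) → ℝ) (hα : IsEuclideanNorm α)
    (β : (Fin n → ℝ) →ₗ[ℝ] ℝ) (hβ : β ≠ 0)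
    (φ : ℝ → ℝ) (b : ℝ) (hb : b = dualNormOf α β) :
    IsMinkowskiNorm (fun x => α x * φ (β x / α x)) ↔
      (∀ s ∈ Set.Icc (-b) b, 0 < φ s) ∧
      ContDiffOn ℝ ∞ φ (Set.Icc (-b) b) ∧
      ∀ s ∈ Set.Icc (-b) b,
        0 < φ s - s * derivWithin φ (Set.Icc (-b) b) s
          + (b ^ 2 - s ^ 2) * iteratedDerivWithin 2 φ (Set.Icc (-b) b) s := by
  obtain ⟨B, hs, hp, hαB⟩ := hα
  obtain rfl : α = fun x => √(B x x) := funext hαB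
  obtain ⟨p, hpβ⟩ := exists_riesz_of_pos hp β
  have hp0 : p ≠ 0 := by
    rintro rfl
    exact hβ (LinearMap.ext fun v => by simp [← hpβ])
  have hbp : b = √(B p p) := hb.trans (dualNorm_eq_sqrt hs hp hpβ)
  have hb0 : 0 < b := hbp ▸ Real.sqrt_pos.2 (hp p hp0)
  have hb2 : b ^ 2 = B p p := by rw [hbp, Real.sq_sqrt (hp p hp0).le]
  obtain ⟨e, f, he, hf, hef, hβe, hβf⟩ := exists_orthonormal_pair
    (by simpa using hn) hp hpβ hp0
  rw [← hbp] at hβe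
  have hI : ∀ y, β y / √(B y y) ∈ Set.Icc (-b) b := by
    intro y
    rcases eq_or_ne y 0 with rfl | hy
    · simpa using hb0.le
    · rw [Set.mem_Icc, ← abs_le, abs_div, abs_of_nonneg (Real.sqrt_nonneg _),
        div_le_iff₀ (Real.sqrt_pos.2 (hp y hy)), hbp, ← Real.sqrt_mul (hp p hp0).le, ← hpβ]
      exact Real.abs_le_sqrt (LinearMap.BilinForm.sq_apply_le_of_pos hs hp p y)
  have hu : UniqueDiffOn ℝ (Set.Icc (-b) b) := uniqueDiffOn_Icc (by linarith)
  set φ₁ := derivWithin φ (Set.Icc (-b) b) with hφ₁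
  set φ₂ := iteratedDerivWithin 2 φ (Set.Icc (-b) b) with hφ₂
  have hderiv : ContDiffOn ℝ ∞ φ (Set.Icc (-b) b) →
      (∀ s ∈ Set.Icc (-b) b, HasDerivWithinAt φ (φ₁ s) (Set.Icc (-b) b) s) ∧
      ∀ s ∈ Set.Icc (-b) b, HasDerivWithinAt φ₁ (φ₂ s) (Set.Icc (-b) b) s := by
    intro h
    have h' : ContDiffOn ℝ ∞ φ₁ (Set.Icc (-b) b) := ((contDiffOn_infty_iff_derivWithin hu).1 h).2
    refine ⟨fun s hs => (h.differentiableOn (by simp) s hs).hasDerivWithinAt, fun s hs => ?_⟩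
    rw [hφ₂, iteratedDerivWithin_succ', iteratedDerivWithin_one]
    exact (h'.differentiableOn (by simp) s hs).hasDerivWithinAt
  constructor
  · intro hF
    have hsm := contDiffOn_of_contDiffOn_alphaBeta hs he hf hef hb0 hβe hβf hF.smooth
    obtain ⟨h₁, h₂⟩ := hderiv hsm
    have hpos : ∀ s ∈ Set.Icc (-b) b, 0 < φ s := by
      intro s hsb
      obtain ⟨x, y, hx, -, -, hβx, -⟩ := exists_unit_apply_eq hs he hf hef hb0 hβe hβf hsb
      have := hF.pos x (by rintro rfl; simp at hx)
      simpa [hx, hβx] using this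
    refine ⟨hpos, hsm, fun s hsb => ?_⟩
    obtain ⟨x, y, hx, hy, hxy, hβx, hβy⟩ := exists_unit_apply_eq hs he hf hef hb0 hβe hβf hsb
    have hx0 : x ≠ 0 := by rintro rfl; simp at hx
    have hq := (posDef_hessianMatrix_alphaBeta_iff hs hp hI h₁ h₂ hx0 (s := s)
      (by simp [hx, hβx])).1 (hF.strongly_convex x hx0)
    have hφs := hpos s hsb
    -- The multiple of `x` is chosen so that `φ ξ + φ' τ = 0`; it leaves `τ = β y` and `N = 1`
    -- unchanged.
    have hBy : B y (y + (-(φ₁ s * β y / φ s)) • x) = 1 := by simp [hy, hs y x, hxy]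
    have h := hq (y + (-(φ₁ s * β y / φ s)) • x) (by intro h; rw [h] at hBy; simp at hBy)
    have e0 : B x (y + (-(φ₁ s * β y / φ s)) • x) = -(φ₁ s * β y / φ s) := by simp [hx, hxy]
    have e1 : B (y + (-(φ₁ s * β y / φ s)) • x) (y + (-(φ₁ s * β y / φ s)) • x) =
        1 + (φ₁ s * β y / φ s) ^ 2 := by
      simp [hx, hy, hxy, hs y x]
      ring
    have e2 : β (y + (-(φ₁ s * β y / φ s)) • x) = β y - s * (φ₁ s * β y / φ s) := by
      simp [hβx]
      ring
    rw [e0, e1, e2, hx] at h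
    have e3 : φ s * (-(φ₁ s * β y / φ s)) = -(φ₁ s * β y) := by field_simp
    simp only [Real.sqrt_one, div_one, e3] at h
    refine pos_of_mul_pos_right (a := φ s) ?_ hφs.le
    refine h.trans_eq ?_
    linear_combination (φ s * φ₂ s) * hβy
  · rintro ⟨hpos, hsm, hcond⟩
    obtain ⟨h₁, h₂⟩ := hderiv hsm
    have hw := sub_mul_derivWithin_pos hb0 h₁ h₂ hcond
    have hαc : ContDiffOn ℝ ∞ (fun x => √(B x x)) {x | x ≠ 0} := by
      have h : ContDiff ℝ ∞ (fun x => B.toContinuousBilinearMap x x) := by fun_prop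
      exact h.contDiffOn.sqrt fun x hx => (hp x hx).ne'
    have hβc : ContDiff ℝ ∞ β := β.toContinuousLinearMap.contDiff
    have hα0 : ∀ x, x ≠ 0 → 0 < √(B x x) := fun x hx => Real.sqrt_pos.2 (hp x hx)
    have hFs : ContDiffOn ℝ ∞ (fun x => √(B x x) * φ (β x / √(B x x))) {x | x ≠ 0} :=
      hαc.mul (hsm.comp (hβc.contDiffOn.div hαc fun x hx => (hα0 x hx).ne') fun x _ => hI x)
    refine ⟨?_, fun x hx => mul_pos (hα0 x hx) (hpos _ (hI x)), hFs, ?_, ?_⟩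
    · rw [continuous_iff_continuousAt]
      intro x
      rcases eq_or_ne x 0 with rfl | hx
      -- At the origin `F` is squeezed by `C α`, as `φ` is bounded on the compact interval.
      · obtain ⟨C, hC⟩ := isCompact_Icc.exists_bound_of_continuousOn hsm.continuousOn
        have hαcont : Continuous fun x => √(B x x) := by
          have h : Continuous (fun x => B.toContinuousBilinearMap x x) := by fun_prop
          exact h.sqrt
        have hlim : Filter.Tendsto (fun x => √(B x x) * C) (nhds 0) (nhds 0) := by
          have := (hαcont.mul_const C).tendsto 0
          simpa using this
        have : Filter.Tendsto (fun x => √(B x x) * φ (β x / √(B x x))) (nhds 0) (nhds 0) := by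
          refine squeeze_zero_norm (fun x => ?_) hlim
          rw [norm_mul, Real.norm_of_nonneg (Real.sqrt_nonneg _)]
          exact mul_le_mul_of_nonneg_left (hC _ (hI x)) (Real.sqrt_nonneg _)
        simpa [ContinuousAt] using this
      · exact (hFs.contDiffAt (isOpen_ne.mem_nhds hx)).continuousAt
    · intro c x hc
      have e : √(B (c • x) (c • x)) = c * √(B x x) := by
        rw [map_smul, map_smul, LinearMap.smul_apply, smul_eq_mul, smul_eq_mul, ← mul_assoc,
          Real.sqrt_mul (mul_self_nonneg c), Real.sqrt_mul_self hc]
      rcases hc.eq_or_lt with rfl | hc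
      · simp
      · simp only [e, map_smul β, smul_eq_mul, mul_div_mul_left _ _ hc.ne', mul_assoc]
    · intro x hx
      refine (posDef_hessianMatrix_alphaBeta_iff hs hp hI h₁ h₂ hx rfl).2 fun v hv => ?_
      have hN : 0 ≤ B v v - (B x v / √(B x x)) ^ 2 := by
        rw [div_pow, Real.sq_sqrt (hp x hx).le, sub_nonneg, div_le_iff₀ (hp x hx), mul_comm]
        exact LinearMap.BilinForm.sq_apply_le_of_pos hs hp x v
      refine sq_add_mul_pos_of_sq_le (hpos _ (hI x)) (hw _ (hI x)) (hcond _ (hI x)) ?_ hN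
        (by simpa using hp v hv)
      rw [hb2]
      exact sq_sub_mul_le hs hp hpβ hx v
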